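/- Let $Q=\{Q(t)\}_{t\ge 0}$ be the Erlang-A ($M(t)/M/c+M$) queue with $c\ge 1$ servers, continuous arrival rate $\lambda(t)\ge 0$, service rate $\mu>0$ and abandonment rate $\theta\ge 0$: the Markov jump process on $\{0,1,2,\dots\}$ that jumps at time $t$ from $n$ to $n+1$ at rate $\lambda(t)$ and from $n$ to $n-1$ at rate $\mu\,(n\wedge c)+\theta\,(n-c)^+$. Let $I\subseteq\mathbb{R}$ be an interval containing $0$ (for example $I=\mathbb{R}$) with $E[e^{\alpha Q(0)}]<\infty$ for $\alpha\in I$, and let the fluid moment generating function $M_f$ be a classical solution, for $t\in[0,T]$ and $\alpha\in I$, of the closure equation $$\frac{\partial M_f}{\partial t}=\lambda(t)(e^{\alpha}-1)M_f+\theta(e^{-\alpha}-1)\frac{\partial M_f}{\partial\alpha}-(\theta-\mu)(e^{-\alpha}-1)\Big(\frac{\partial M_f}{\partial\alpha}\wedge c\,M_f\Big),$$ that is, of the equation for $E[e^{\alpha Q(t)}]$ in which $E[(Q\wedge c)e^{\alpha Q}]$ is replaced by $\partial_\alpha M_f\wedge cM_f$, with the same initial value as the queue, $M_f(0,\alpha)=E[e^{\alpha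 Q(0)}]$ for $\alpha\in I$. (Classical: $M_f$ is continuous on $[0,T]\times I$, and for $0<t<T$ both partial derivatives exist, one-sided in $\alpha$ at an endpoint of $I$, and satisfy the equation.) Then for all $t\in[0,T]$ and $\alpha\in I$ the expectation $E[e^{\alpha Q(t)}]$ is finite, and 1. if $\theta<\mu$, then $E[e^{\alpha Q(t)}]\ge M_f(t,\alpha)$ when $\alpha\ge 0$, and $E[e^{\alpha Q(t)}]\le M_f(t,\alpha)$ when $\alpha\le 0$; 2. if $\theta>\mu$, then $E[e^{\alpha Q(t)}]\le M_f(t,\alpha)$ when $\alpha\ge 0$, and $E[e^{\alpha Q(t)}]\ge M_f(t,\alpha)$ when $\alpha\le 0$; 3. if $\theta=\mu$, then $E[e^{\alpha Q(t)}]=M_f(t,\alpha)$. -/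

import Mathlib

open MeasureTheory ProbabilityTheory Set Filter Topology
open scoped NNReal

noncomputable section

/-- Total departure rate of the Erlang-A queue in state `n`: service at rate `μ` by each of the
`min n c` busy servers, abandonment at rate `θ` by each of the `(n - c)⁺` waiting customers. -/
def erlangADeparture (μ θ : ℝ) (c n : ℕ) : ℝ :=
  μ * min (n : ℝ) (c : ℝ) + θ * max ((n : ℝ) - c) 0

/-- Generator of the Erlang-A (`M(t)/M/c+M`) birth-death process, when the current arrival rate
is `r`. In state `0` the departure rate vanishes, so that the value of `n - 1` is irrelevant. -/
def erlangAGenerator (r μ θ : ℝ) (c : ℕ) (f : ℕ → ℝ) (n : ℕ) : ℝ :=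
  r * (f (n + 1) - f n) + erlangADeparture μ θ c n * (f (n - 1) - f n)

/-- The process `Q` is an Erlang-A queue with arrival rate `lam`, service rate `μ`, abandonment
rate `θ` and `c` servers, with respect to the filtration `ℱ`: it is adapted, has right-continuous
paths with left limits in the discrete space `ℕ`, and is the Markov jump process whose only
transitions are `n ↦ n + 1` at rate `lam t` and `n ↦ n - 1` at rate
`μ * (n ∧ c) + θ * (n - c)⁺`, in the sense of the martingale problem for its generator, with
finitely supported test functions. The initial law is arbitrary. -/
structure IsErlangA {Ω : Type*} [mΩ : MeasurableSpace Ω] (P : Measure Ω)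
    (ℱ : Filtration ℝ≥0 mΩ)
    (lam : ℝ → ℝ) (μ θ : ℝ) (c : ℕ) (Q : ℝ≥0 → Ω → ℕ) : Prop where
  adapted : ∀ t, Measurable[ℱ t] (Q t)
  right_continuous : ∀ ω t, ContinuousWithinAt (fun s => Q s ω) (Ici t) t
  left_limits : ∀ ω t, ∃ n : ℕ, Tendsto (fun s => Q s ω) (𝓝[<] t) (𝓝 n)
  martingale : ∀ f : ℕ → ℝ, f.support.Finite →
    Martingale (fun (t : ℝ≥0) ω => f (Q t ω) -
      ∫ s in (0 : ℝ)..t, erlangAGenerator (lam s) μ θ c f (Q s.toNNReal ω)) ℱ P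

/-- Right-hand side of the closure equation, at arrival rate `r`, for the value `m` of the fluid
moment generating function and the value `p` of its derivative in `α`. -/
def fluidRHS (r μ θ : ℝ) (c : ℕ) (α m p : ℝ) : ℝ :=
  r * (Real.exp α - 1) * m + θ * (Real.exp (-α) - 1) * p
    - (θ - μ) * (Real.exp (-α) - 1) * min p (c * m)

/-- The function `M t α` is a classical solution, for times in `[0, T]` and `α ∈ I`, of the
closure equation `∂ₜ M = fluidRHS (lam t) μ θ c α M (∂_α M)`: it is continuous, and at all times in
`(0, T)` both partial derivatives exist (the one in `α` relative to `I`) and satisfy the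
equation. -/
structure IsFluidMGF (lam : ℝ → ℝ) (μ θ : ℝ) (c : ℕ) (T : ℝ) (I : Set ℝ)
    (M : ℝ → ℝ → ℝ) : Prop where
  continuousOn : ContinuousOn (fun x : ℝ × ℝ => M x.1 x.2) (Icc 0 T ×ˢ I)
  pde : ∀ t ∈ Ioo 0 T, ∀ α ∈ I, ∃ p : ℝ,
    HasDerivWithinAt (fun β => M t β) p I α ∧
    HasDerivAt (fun s => M s α) (fluidRHS (lam t) μ θ c α (M t α) p) t

end

/-!
The moment generating function `M` of the queue has `E[(Q ∧ c) exp (α Q)] ≤ ∂_α M ∧ c M`, since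
`x ↦ x ∧ c` is concave. So `M` satisfies the closure equation up to an error with the sign of
`(e^(-α) - 1) (θ - μ)`: on a segment from `0` to `a` it is a subsolution if `(θ - μ) a ≥ 0`, and a
supersolution if `(θ - μ) a ≤ 0`.

The characteristics of the closure equation move away from `α = 0`, because the mean departure rate
is monotone in `∂_α M`. Where the difference of a sub- and a supersolution, discounted at a large
rate, is maximal over a segment from `0` to `a`, its transport term therefore has the right sign
even at the endpoint `a`, and the maximum principle compares the two with no boundary condition
besides the total mass at `α = 0`.

The martingale problem only controls finitely supported test functions. Applied to
`exp (b (Q ∧ N))`, minus its value at infinity, it propagates a finite exponential moment from time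
`0` to all times; Dynkin's formula then extends to functions of smaller exponential growth and gives
the regularity of `M` in time.
-/
section Analysis

lemma measurable_uncurry_of_rightContinuous {Ω E : Type*} [MeasurableSpace Ω]
    [TopologicalSpace E] [TopologicalSpace.PseudoMetrizableSpace E] [MeasurableSpace E]
    [BorelSpace E] {X : ℝ≥0 → Ω → E} (hX : ∀ t, Measurable (X t))
    (hright : ∀ ω t, ContinuousWithinAt (fun s => X s ω) (Ici t) t) :
    Measurable (Function.uncurry X) := by
  have hceil (t : ℝ≥0) : Tendsto (fun k : ℕ => (⌈t * k⌉₊ / k : ℝ≥0)) atTop (𝓝[≥] t) := by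
    refine tendsto_nhdsWithin_iff.2 ⟨?_, (eventually_gt_atTop 0).mono fun k hk => ?_⟩
    · rw [← NNReal.tendsto_coe]
      refine ((tendsto_nat_ceil_mul_div_atTop t.coe_nonneg).comp
        tendsto_natCast_atTop_atTop).congr fun k => ?_
      have hcoe : ⌈(t : ℝ) * k⌉₊ = ⌈t * k⌉₊ := Nonneg.nat_ceil_coe (t * (k : ℝ≥0))
      simp only [Function.comp_apply, NNReal.coe_div, NNReal.coe_natCast, hcoe]
    · rw [mem_Ici, le_div_iff₀ (by exact_mod_cast hk)]
      exact Nat.le_ceil _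
  refine measurable_of_tendsto_metrizable
    (f := fun (k : ℕ) (x : ℝ≥0 × Ω) => X (⌈x.1 * k⌉₊ / k) x.2) (fun k => ?_)
    (tendsto_pi_nhds.2 fun x => (hright x.2 x.1).tendsto.comp (hceil x.1))
  have hgrid : Measurable fun y : ℕ × Ω => X (y.1 / k) y.2 :=
    measurable_from_prod_countable_right fun n => hX (n / k)
  exact hgrid.comp (((Nat.measurable_ceil.comp (measurable_id.mul_const _)).comp
    measurable_fst).prodMk measurable_snd)

lemma integrable_and_integral_le_of_tendsto_of_nonneg {Ω : Type*} [MeasurableSpace Ω]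
    {P : Measure Ω} {F : ℕ → Ω → ℝ} {X : Ω → ℝ} {B : ℝ} (hF : ∀ N, Integrable (F N) P)
    (hF0 : ∀ N ω, 0 ≤ F N ω)
    (hlim : ∀ ω, Tendsto (fun N => F N ω) atTop (𝓝 (X ω))) (hB : ∀ N, ∫ ω, F N ω ∂P ≤ B) :
    Integrable X P ∧ ∫ ω, X ω ∂P ≤ B := by
  have hX0 ω : 0 ≤ X ω := ge_of_tendsto' (hlim ω) fun N => hF0 N ω
  have hB0 : 0 ≤ B := (integral_nonneg (hF0 0)).trans (hB 0)
  have hXm : AEStronglyMeasurable X P := aestronglyMeasurable_of_tendsto_ae atTop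
    (fun N => (hF N).aestronglyMeasurable) (Eventually.of_forall hlim)
  have hle : ∫⁻ ω, ‖X ω‖ₑ ∂P ≤ ENNReal.ofReal B := by
    simp only [← (hlim _).enorm.liminf_eq]
    refine (lintegral_liminf_le' fun N => (hF N).aestronglyMeasurable.enorm).trans
      (liminf_le_of_le (by isBoundedDefault) fun b hb => ?_)
    obtain ⟨N, hN⟩ := hb.exists
    refine hN.trans ?_
    rw [← ofReal_integral_norm_eq_lintegral_enorm (hF N)]
    simpa only [Real.norm_of_nonneg (hF0 N _)] using ENNReal.ofReal_le_ofReal (hB N)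
  have hXi : Integrable X P := ⟨hXm, hle.trans_lt ENNReal.ofReal_lt_top⟩
  refine ⟨hXi, (ENNReal.ofReal_le_ofReal_iff hB0).1 (le_trans (le_of_eq ?_) hle)⟩
  rw [← ofReal_integral_norm_eq_lintegral_enorm hXi]
  simp only [Real.norm_of_nonneg (hX0 _)]

lemma le_mul_exp_of_le_add_integral {U : ℝ → ℝ} (hU : Continuous U) {u₀ K a b : ℝ} (hK : 0 ≤ K)
    (h : ∀ t ∈ Icc a b, U t ≤ u₀ + ∫ s in a..t, K * U s) :
    ∀ t ∈ Icc a b, U t ≤ u₀ * Real.exp (K * (t - a)) := by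
  have hderiv t : HasDerivAt (fun t => u₀ + ∫ s in a..t, K * U s) (K * U t) t :=
    ((continuous_const.mul hU).integral_hasStrictDerivAt a t).hasDerivAt.const_add u₀
  intro t ht
  rw [← gronwallBound_ε0]
  refine (h t ht).trans (le_gronwallBound_of_liminf_deriv_right_le (ε := 0)
    (fun s _ => (hderiv s).continuousAt.continuousWithinAt)
    (fun s _ r hr => (hderiv s).hasDerivWithinAt.liminf_right_slope_le hr) (by simp)
    (fun s hs => ?_) t ht)
  simpa only [add_zero] using mul_le_mul_of_nonneg_left (h s (Ico_subset_Icc_self hs)) hK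

section Monotone

variable {X A B : Type*} [TopologicalSpace X] [LinearOrder A] [TopologicalSpace A]
  [OrderTopology A] [LinearOrder B] {f : X → A → B} {S : Set X} {J : Set A}

lemma lowerSemicontinuousOn_prod_of_monotoneOn
    (hleft : ∀ a ∈ J, LowerSemicontinuousOn (fun x => f x a) S)
    (hright : ∀ x ∈ S, LowerSemicontinuousOn (f x) J) (hmono : ∀ x ∈ S, MonotoneOn (f x) J) :
    LowerSemicontinuousOn (fun z : X × A => f z.1 z.2) (S ×ˢ J) := by
  rintro ⟨x₀, a₀⟩ ⟨hx₀, ha₀⟩ u hu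
  obtain ⟨a₁, ha₁, hua₁, hnear⟩ : ∃ a₁ ∈ J, u < f x₀ a₁ ∧ ∀ᶠ a in 𝓝[J] a₀, a₁ ≤ a := by
    by_cases hisol : ∀ᶠ a in 𝓝[J] a₀, a₀ ≤ a
    · exact ⟨a₀, ha₀, hu, hisol⟩
    · obtain ⟨a₁, hlt, hua₁, ha₁⟩ := ((not_eventually.1 hisol).and_eventually
        ((hright x₀ hx₀ a₀ ha₀ u hu).and self_mem_nhdsWithin)).exists
      exact ⟨a₁, ha₁, hua₁, mem_nhdsWithin_of_mem_nhds (Ici_mem_nhds (not_le.1 hlt))⟩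
  rw [nhdsWithin_prod_eq]
  filter_upwards [((hleft a₁ ha₁ x₀ hx₀ u hua₁).and self_mem_nhdsWithin).prod_mk
    (hnear.and self_mem_nhdsWithin)] with z ⟨⟨hu, hz₁⟩, hle, hz₂⟩
  exact hu.trans_le (hmono z.1 hz₁ ha₁ hz₂ hle)

lemma continuousOn_prod_of_monotoneOn [TopologicalSpace B] [OrderTopology B]
    (hleft : ∀ a ∈ J, ContinuousOn (fun x => f x a) S)
    (hright : ∀ x ∈ S, ContinuousOn (f x) J) (hmono : ∀ x ∈ S, MonotoneOn (f x) J) :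
    ContinuousOn (fun z : X × A => f z.1 z.2) (S ×ˢ J) := by
  refine continuousOn_iff_lower_upperSemicontinuousOn.2
    ⟨lowerSemicontinuousOn_prod_of_monotoneOn (fun a ha => (hleft a ha).lowerSemicontinuousOn)
      (fun x hx => (hright x hx).lowerSemicontinuousOn) hmono, ?_⟩
  exact lowerSemicontinuousOn_prod_of_monotoneOn (A := Aᵒᵈ) (B := Bᵒᵈ)
    (fun a ha => (hleft a ha).upperSemicontinuousOn)
    (fun x hx => (hright x hx).upperSemicontinuousOn) fun x hx => (hmono x hx).dual

end Monotone

lemma sub_mul_nonpos_of_isMaxOn {f : ℝ → ℝ} {p x y : ℝ} {s : Set ℝ} (hs : Convex ℝ s)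
    (hx : x ∈ s) (hy : y ∈ s) (hmax : IsMaxOn f s x) (hf : HasDerivWithinAt f p s x) :
    (y - x) * p ≤ 0 := by
  simpa using hmax.localize.hasFDerivWithinAt_nonpos hf.hasFDerivWithinAt
    (sub_mem_posTangentConeAt_of_segment_subset (hs.segment_subset hx hy))

section MaximumPrinciple

variable {D : ℝ → ℝ → ℝ} {T K a : ℝ}

/- At a positive maximum of `exp (-(K + 1) * t) * D t α` the derivative in `α` points away
from `0`, so that `∂ₜ D ≤ K * D < (K + 1) * D` there, against maximality in `t`. -/
lemma nonpos_of_outflow_of_lt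
    (hD : ContinuousOn (fun z : ℝ × ℝ => D z.1 z.2) (Icc 0 T ×ˢ uIcc 0 a))
    (hinit : ∀ α ∈ uIcc 0 a, D 0 α ≤ 0) (hbdry : ∀ t ∈ Icc 0 T, D t 0 ≤ 0)
    (hderiv : ∀ t ∈ Ioo 0 T, ∀ α ∈ uIcc 0 a, α ≠ 0 → 0 < D t α → ∃ p q,
      HasDerivWithinAt (D t) p (uIcc 0 a) α ∧ HasDerivAt (fun s => D s α) q t ∧
      (0 ≤ α * p → q ≤ K * D t α)) :
    ∀ t ∈ Ico 0 T, ∀ α ∈ uIcc 0 a, D t α ≤ 0 := by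
  intro t ht α hα
  by_contra! hpos
  have hweight (s : ℝ) : 0 < Real.exp (-((K + 1) * s)) := Real.exp_pos _
  have htα : (t, α) ∈ Icc 0 t ×ˢ uIcc 0 a := ⟨right_mem_Icc.2 ht.1, hα⟩
  obtain ⟨⟨s, β⟩, ⟨hs, hβ⟩, hmax⟩ := (isCompact_Icc.prod isCompact_uIcc).exists_isMaxOn ⟨_, htα⟩
    (f := fun z : ℝ × ℝ => Real.exp (-((K + 1) * z.1)) * D z.1 z.2)
    ((by fun_prop : Continuous fun z : ℝ × ℝ => Real.exp (-((K + 1) * z.1))).continuousOn.mul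
      (hD.mono (prod_mono_left (Icc_subset_Icc_right ht.2.le))))
  dsimp only at hs hβ
  have hDpos : 0 < D s β :=
    (mul_pos_iff_of_pos_left (hweight s)).1 ((mul_pos (hweight t) hpos).trans_le (hmax htα))
  have hs0 : 0 < s := hs.1.lt_of_ne (by rintro rfl; exact (hinit β hβ).not_gt hDpos)
  have hβ0 : β ≠ 0 := by
    rintro rfl; exact (hbdry s ⟨hs.1, hs.2.trans ht.2.le⟩).not_gt hDpos
  obtain ⟨p, q, hp, hq, hpq⟩ := hderiv s ⟨hs0, hs.2.trans_lt ht.2⟩ β hβ hβ0 hDpos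
  have hmaxα : IsMaxOn (D s) (uIcc 0 a) β := fun γ hγ =>
    le_of_mul_le_mul_left (hmax (⟨hs, hγ⟩ : (s, γ) ∈ Icc 0 t ×ˢ uIcc 0 a)) (hweight s)
  have hmaxt : IsMaxOn (fun r => Real.exp (-((K + 1) * r)) * D r β) (Icc 0 t) s := fun r hr =>
    hmax (⟨hr, hβ⟩ : (r, β) ∈ Icc 0 t ×ˢ uIcc 0 a)
  have hp0 := sub_mul_nonpos_of_isMaxOn (convex_uIcc _ _) hβ left_mem_uIcc hmaxα hp
  have hq0 := sub_mul_nonpos_of_isMaxOn (convex_Icc _ _) hs (left_mem_Icc.2 ht.1) hmaxt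
    ((((hasDerivAt_id s).const_mul (K + 1)).neg.exp).mul hq).hasDerivWithinAt
  have hqle : q ≤ K * D s β := hpq (by linarith)
  have hdecr : s * Real.exp (-((K + 1) * s)) * (q - (K + 1) * D s β) < 0 :=
    mul_neg_of_pos_of_neg (mul_pos hs0 (hweight s)) (by linarith)
  simp only [id, Pi.neg_apply, mul_one] at hq0
  nlinarith

/-- The characteristics point away from `0`, so that no condition is needed at the endpoint `a`. -/
lemma nonpos_of_outflow
    (hD : ContinuousOn (fun z : ℝ × ℝ => D z.1 z.2) (Icc 0 T ×ˢ uIcc 0 a))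
    (hinit : ∀ α ∈ uIcc 0 a, D 0 α ≤ 0) (hbdry : ∀ t ∈ Icc 0 T, D t 0 ≤ 0)
    (hderiv : ∀ t ∈ Ioo 0 T, ∀ α ∈ uIcc 0 a, α ≠ 0 → 0 < D t α → ∃ p q,
      HasDerivWithinAt (D t) p (uIcc 0 a) α ∧ HasDerivAt (fun s => D s α) q t ∧
      (0 ≤ α * p → q ≤ K * D t α)) :
    ∀ t ∈ Icc 0 T, ∀ α ∈ uIcc 0 a, D t α ≤ 0 := by
  intro t ht α hα
  rcases (ht.1.trans ht.2).eq_or_lt with rfl | hT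
  · rw [le_antisymm ht.2 ht.1]
    exact hinit α hα
  · have hclosure : closure (Ico 0 T) = Icc 0 T := closure_Ico hT.ne
    refine le_on_closure (fun s hs => nonpos_of_outflow_of_lt hD hinit hbdry hderiv s hs α hα)
      ?_ continuousOn_const (hclosure ▸ ht)
    rw [hclosure]
    exact hD.comp (f := fun s : ℝ => (s, α)) (by fun_prop) fun s hs => ⟨hs, hα⟩

end MaximumPrinciple

end Analysis

section FluidEquation

lemma mul_exp_neg_sub_one_nonpos {α p : ℝ} (h : 0 ≤ α * p) : (Real.exp (-α) - 1) * p ≤ 0 := by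
  rcases lt_trichotomy α 0 with hα | rfl | hα
  · exact mul_nonpos_of_nonneg_of_nonpos (sub_nonneg.2 (Real.one_le_exp (by linarith)))
      (nonpos_of_mul_nonneg_right h hα)
  · simp
  · exact mul_nonpos_of_nonpos_of_nonneg (sub_nonpos.2 (Real.exp_le_one_iff.2 (by linarith)))
      (nonneg_of_mul_nonneg_right h hα)

/-- The closure of the mean departure rate `E[d(Q) exp (α * Q)]`, where `d` is `erlangADeparture`,
in terms of `m = E[exp (α * Q)]` and `p = E[Q * exp (α * Q)]`. -/
def fluidDeparture (μ θ : ℝ) (c : ℕ) (m p : ℝ) : ℝ :=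
  μ * min p (c * m) + θ * max (p - c * m) 0

variable {r μ θ m p mf pf α : ℝ} {c : ℕ}

lemma fluidDeparture_eq (μ θ : ℝ) (c : ℕ) (m p : ℝ) :
    fluidDeparture μ θ c m p = θ * p - (θ - μ) * min p (c * m) := by
  have hmax : max (p - c * m) 0 = p - min p (c * m) := by
    rcases le_total p (c * m) with h | h <;> simp [h]
  rw [fluidDeparture, hmax]
  ring

lemma fluidRHS_eq (r μ θ : ℝ) (c : ℕ) (α m p : ℝ) :
    fluidRHS r μ θ c α m p =
      r * (Real.exp α - 1) * m + (Real.exp (-α) - 1) * fluidDeparture μ θ c m p := by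
  rw [fluidRHS, fluidDeparture_eq]
  ring

lemma monotone_fluidDeparture (hμ : 0 ≤ μ) (hθ : 0 ≤ θ) : Monotone (fluidDeparture μ θ c m) := by
  intro p q hpq
  unfold fluidDeparture
  gcongr

lemma abs_fluidDeparture_sub_le (μ θ : ℝ) (c : ℕ) (m mf p : ℝ) :
    |fluidDeparture μ θ c m p - fluidDeparture μ θ c mf p| ≤ |θ - μ| * (c * |m - mf|) :=
  calc |fluidDeparture μ θ c m p - fluidDeparture μ θ c mf p|
      = |θ - μ| * |min (c * m) p - min (c * mf) p| := by
        rw [fluidDeparture_eq, fluidDeparture_eq, min_comm p, min_comm p, ← abs_mul,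
          ← abs_neg ((θ - μ) * _)]
        ring_nf
    _ ≤ |θ - μ| * |c * m - c * mf| :=
        mul_le_mul_of_nonneg_left (abs_inf_sub_inf_le_abs _ _ _) (abs_nonneg _)
    _ = |θ - μ| * (c * |m - mf|) := by rw [← mul_sub, abs_mul, Nat.abs_cast]

lemma fluidRHS_sub_le (hμ : 0 ≤ μ) (hθ : 0 ≤ θ) (hm : mf ≤ m) (hp : 0 ≤ α * (p - pf)) :
    fluidRHS r μ θ c α m p - fluidRHS r μ θ c α mf pf ≤
      (r * (Real.exp α - 1) + |Real.exp (-α) - 1| * (|θ - μ| * c)) * (m - mf) := by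
  have hmono : (Real.exp (-α) - 1) *
      (fluidDeparture μ θ c m p - fluidDeparture μ θ c m pf) ≤ 0 := by
    refine mul_exp_neg_sub_one_nonpos ?_
    rcases lt_trichotomy α 0 with hα | rfl | hα
    · have hle : p ≤ pf := sub_nonpos.1 (nonpos_of_mul_nonneg_right hp hα)
      exact mul_nonneg_of_nonpos_of_nonpos hα.le
        (sub_nonpos.2 (monotone_fluidDeparture hμ hθ hle))
    · simp
    · have hle : pf ≤ p := sub_nonneg.1 (nonneg_of_mul_nonneg_right hp hα)
      exact mul_nonneg hα.le (sub_nonneg.2 (monotone_fluidDeparture hμ hθ hle))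
  have hlip : (Real.exp (-α) - 1) * (fluidDeparture μ θ c m pf - fluidDeparture μ θ c mf pf) ≤
      |Real.exp (-α) - 1| * (|θ - μ| * (c * (m - mf))) := by
    refine (le_abs_self _).trans ?_
    rw [abs_mul]
    gcongr
    simpa only [abs_of_nonneg (sub_nonneg.2 hm)] using abs_fluidDeparture_sub_le μ θ c m mf pf
  rw [fluidRHS_eq, fluidRHS_eq]
  linarith

/-- Classical subsolutions of the closure equation, for times in `[0, T]` and `α ∈ J`. Nothing is
required of the derivatives at `α = 0`, where the closure equation has no transport. -/
structure IsFluidSubsolution (lam : ℝ → ℝ) (μ θ : ℝ) (c : ℕ) (T : ℝ) (J : Set ℝ)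
    (u : ℝ → ℝ → ℝ) : Prop where
  continuousOn : ContinuousOn (fun z : ℝ × ℝ => u z.1 z.2) (Icc 0 T ×ˢ J)
  deriv_le : ∀ t ∈ Ioo 0 T, ∀ α ∈ J, α ≠ 0 → ∃ p q,
    HasDerivWithinAt (u t) p J α ∧ HasDerivAt (fun s => u s α) q t ∧
    q ≤ fluidRHS (lam t) μ θ c α (u t α) p

/-- Classical supersolutions of the closure equation, with the conventions of
`IsFluidSubsolution`. -/
structure IsFluidSupersolution (lam : ℝ → ℝ) (μ θ : ℝ) (c : ℕ) (T : ℝ) (J : Set ℝ)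
    (v : ℝ → ℝ → ℝ) : Prop where
  continuousOn : ContinuousOn (fun z : ℝ × ℝ => v z.1 z.2) (Icc 0 T ×ˢ J)
  le_deriv : ∀ t ∈ Ioo 0 T, ∀ α ∈ J, α ≠ 0 → ∃ p q,
    HasDerivWithinAt (v t) p J α ∧ HasDerivAt (fun s => v s α) q t ∧
    fluidRHS (lam t) μ θ c α (v t α) p ≤ q

variable {lam : ℝ → ℝ} {T a : ℝ} {u v : ℝ → ℝ → ℝ}

lemma IsFluidSubsolution.le_supersolution (hu : IsFluidSubsolution lam μ θ c T (uIcc 0 a) u)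
    (hv : IsFluidSupersolution lam μ θ c T (uIcc 0 a) v) (hlam : ContinuousOn lam (Icc 0 T))
    (hμ : 0 ≤ μ) (hθ : 0 ≤ θ) (hinit : ∀ α ∈ uIcc 0 a, u 0 α ≤ v 0 α)
    (hbdry : ∀ t ∈ Icc 0 T, u t 0 ≤ v t 0) :
    ∀ t ∈ Icc 0 T, ∀ α ∈ uIcc 0 a, u t α ≤ v t α := by
  obtain ⟨K, hK⟩ := (isCompact_Icc.prod isCompact_uIcc).exists_bound_of_continuousOn
    (f := fun z : ℝ × ℝ =>
      lam z.1 * (Real.exp z.2 - 1) + |Real.exp (-z.2) - 1| * (|θ - μ| * c))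
    (s := Icc 0 T ×ˢ uIcc 0 a)
    (((hlam.comp continuousOn_fst fun z hz => hz.1).mul (by fun_prop)).add (by fun_prop))
  intro t ht α hα
  refine sub_nonpos.1 (nonpos_of_outflow (D := fun t α => u t α - v t α) (K := K)
    (hu.continuousOn.sub hv.continuousOn) (fun α hα => sub_nonpos.2 (hinit α hα))
    (fun t ht => sub_nonpos.2 (hbdry t ht)) (fun t ht α hα hα0 hpos => ?_) t ht α hα)
  obtain ⟨pu, qu, hpu, hqu, hle⟩ := hu.deriv_le t ht α hα hα0
  obtain ⟨pv, qv, hpv, hqv, hge⟩ := hv.le_deriv t ht α hα hα0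
  refine ⟨pu - pv, qu - qv, hpu.sub hpv, hqu.sub hqv, fun hp => ?_⟩
  calc qu - qv ≤ _ := sub_le_sub hle hge
    _ ≤ _ := fluidRHS_sub_le hμ hθ (sub_pos.1 hpos).le hp
    _ ≤ K * (u t α - v t α) := mul_le_mul_of_nonneg_right
      ((Real.le_norm_self _).trans (hK (t, α) ⟨Ioo_subset_Icc_self ht, hα⟩)) hpos.le

variable {I J : Set ℝ} {M : ℝ → ℝ → ℝ}

lemma IsFluidMGF.isFluidSubsolution (hM : IsFluidMGF lam μ θ c T I M) (hJ : J ⊆ I) :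
    IsFluidSubsolution lam μ θ c T J M where
  continuousOn := hM.continuousOn.mono (prod_mono_right hJ)
  deriv_le t ht α hα _ :=
    have ⟨p, hp, hq⟩ := hM.pde t ht α (hJ hα)
    ⟨p, _, hp.mono hJ, hq, le_rfl⟩

lemma IsFluidMGF.isFluidSupersolution (hM : IsFluidMGF lam μ θ c T I M) (hJ : J ⊆ I) :
    IsFluidSupersolution lam μ θ c T J M where
  continuousOn := hM.continuousOn.mono (prod_mono_right hJ)
  le_deriv t ht α hα _ :=
    have ⟨p, hp, hq⟩ := hM.pde t ht α (hJ hα)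
    ⟨p, _, hp.mono hJ, hq, le_rfl⟩

lemma IsFluidMGF.congr_lam {lam' : ℝ → ℝ} (hM : IsFluidMGF lam μ θ c T I M)
    (h : EqOn lam lam' (Ici 0)) : IsFluidMGF lam' μ θ c T I M where
  continuousOn := hM.continuousOn
  pde t ht α hα :=
    have ⟨p, hp, hq⟩ := hM.pde t ht α hα
    ⟨p, hp, h (mem_Ici.2 ht.1.le) ▸ hq⟩

lemma IsFluidMGF.apply_zero (hM : IsFluidMGF lam μ θ c T I M) (hI0 : (0 : ℝ) ∈ I) {t : ℝ}
    (ht : t ∈ Icc 0 T) : M t 0 = M 0 0 := by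
  have hcont : ContinuousOn (fun s => M s 0) (Icc 0 t) :=
    hM.continuousOn.comp (f := fun s : ℝ => (s, (0 : ℝ))) (by fun_prop)
      fun s hs => ⟨⟨hs.1, hs.2.trans ht.2⟩, hI0⟩
  have hderiv : ∀ s ∈ Ioo 0 t, HasDerivAt (fun s => M s 0) 0 s := fun s hs => by
    obtain ⟨p, -, hq⟩ := hM.pde s ⟨hs.1, hs.2.trans_le ht.2⟩ 0 hI0
    simpa [fluidRHS] using hq
  rcases ht.1.eq_or_lt with rfl | ht0
  · rfl
  · obtain ⟨s, -, hslope⟩ := exists_hasDerivAt_eq_slope _ _ ht0 hcont hderiv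
    exact sub_eq_zero.1 ((div_eq_zero_iff.1 hslope.symm).resolve_right (sub_pos.2 ht0).ne')

end FluidEquation

section Generator

open Asymptotics

variable {r μ θ b β : ℝ} {c : ℕ} {f : ℕ → ℝ}

lemma erlangADeparture_nonneg (hμ : 0 ≤ μ) (hθ : 0 ≤ θ) (c n : ℕ) :
    0 ≤ erlangADeparture μ θ c n := by
  unfold erlangADeparture
  positivity

lemma erlangADeparture_eq (μ θ : ℝ) (c n : ℕ) :
    erlangADeparture μ θ c n = θ * n - (θ - μ) * min (n : ℝ) c := by
  simpa [fluidDeparture, erlangADeparture] using fluidDeparture_eq μ θ c 1 n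

lemma erlangAGenerator_exp (r μ θ : ℝ) (c : ℕ) (α : ℝ) (n : ℕ) :
    erlangAGenerator r μ θ c (fun m => Real.exp (α * m)) n =
      r * (Real.exp α - 1) * Real.exp (α * n) +
        (Real.exp (-α) - 1) * (erlangADeparture μ θ c n * Real.exp (α * n)) := by
  rcases n with - | n
  · simp [erlangAGenerator, erlangADeparture]
  · simp only [erlangAGenerator, Nat.add_sub_cancel, Nat.cast_add, Nat.cast_one, mul_add, mul_one,
      Real.exp_add, Real.exp_neg]
    field_simp

lemma erlangAGenerator_exp_min_le (hr : 0 ≤ r) (hμ : 0 ≤ μ) (hθ : 0 ≤ θ) (c : ℕ) (hb : 0 ≤ b)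
    (N n : ℕ) :
    erlangAGenerator r μ θ c (fun m => Real.exp (b * (min m N : ℕ))) n ≤
      r * (Real.exp b - 1) * Real.exp (b * (min n N : ℕ)) := by
  have hup : Real.exp (b * (min (n + 1) N : ℕ)) ≤
      Real.exp b * Real.exp (b * (min n N : ℕ)) := by
    have hmin : ((min (n + 1) N : ℕ) : ℝ) ≤ 1 + (min n N : ℕ) := by
      exact_mod_cast (by omega : min (n + 1) N ≤ 1 + min n N)
    rw [← Real.exp_add, ← mul_one_add]
    gcongr
  have hdown : Real.exp (b * (min (n - 1) N : ℕ)) ≤ Real.exp (b * (min n N : ℕ)) := by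
    gcongr
    exact Nat.sub_le n 1
  calc erlangAGenerator r μ θ c (fun m => Real.exp (b * (min m N : ℕ))) n
      ≤ r * (Real.exp b * Real.exp (b * (min n N : ℕ)) - Real.exp (b * (min n N : ℕ))) + 0 := by
        unfold erlangAGenerator
        gcongr
        exact mul_nonpos_of_nonneg_of_nonpos (erlangADeparture_nonneg hμ hθ c n)
          (sub_nonpos.2 hdown)
    _ = r * (Real.exp b - 1) * Real.exp (b * (min n N : ℕ)) := by ring

lemma isBigO_erlangADeparture (μ θ : ℝ) (c : ℕ) :
    erlangADeparture μ θ c =O[atTop] fun n : ℕ => (n : ℝ) := by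
  have hmin : (fun n : ℕ => min (n : ℝ) c) =O[atTop] fun n : ℕ => (n : ℝ) :=
    isBigO_of_le _ fun n => by
      rw [Real.norm_of_nonneg (by positivity), Real.norm_of_nonneg (by positivity)]
      exact min_le_left _ _
  have hmax : (fun n : ℕ => max ((n : ℝ) - c) 0) =O[atTop] fun n : ℕ => (n : ℝ) :=
    isBigO_of_le _ fun n => by
      rw [Real.norm_of_nonneg (le_max_right _ _), Real.norm_of_nonneg (by positivity)]
      exact max_le (sub_le_self _ (by positivity)) (by positivity)
  exact (hmin.const_mul_left μ).add (hmax.const_mul_left θ)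

lemma isBigO_exp_mul_of_le (h : β ≤ b) :
    (fun n : ℕ => Real.exp (β * n)) =O[atTop] fun n : ℕ => Real.exp (b * n) :=
  isBigO_of_le _ fun n => by
    rw [Real.norm_of_nonneg (by positivity), Real.norm_of_nonneg (by positivity)]
    gcongr

lemma isBigO_exp_mul_of_finite_support (hf : f.support.Finite) (β : ℝ) :
    f =O[atTop] fun n : ℕ => Real.exp (β * n) := by
  have hzero : f =ᶠ[atTop] 0 := by
    filter_upwards [Nat.cofinite_eq_atTop ▸ hf.compl_mem_cofinite] with n hn
    exact Function.notMem_support.1 hn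
  exact hzero.trans_isBigO (isBigO_zero _ _)

lemma isBigO_comp_succ (hf : f =O[atTop] fun n : ℕ => Real.exp (β * n)) :
    (fun n => f (n + 1)) =O[atTop] fun n : ℕ => Real.exp (β * n) := by
  refine (hf.comp_tendsto (tendsto_add_atTop_nat 1)).trans
    (((isBigO_refl _ _).const_mul_left (Real.exp β)).congr_left fun n => ?_)
  rw [Function.comp_apply, ← Real.exp_add]
  push_cast
  ring_nf

lemma isBigO_comp_pred (hf : f =O[atTop] fun n : ℕ => Real.exp (β * n)) :
    (fun n => f (n - 1)) =O[atTop] fun n : ℕ => Real.exp (β * n) := by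
  refine (hf.comp_tendsto (tendsto_sub_atTop_nat 1)).trans
    (((isBigO_refl _ _).const_mul_left (Real.exp (-β))).congr' ?_ .rfl)
  filter_upwards [eventually_ge_atTop 1] with n hn
  rw [Function.comp_apply, ← Real.exp_add, Nat.cast_sub hn]
  push_cast
  ring_nf

lemma isBigO_erlangADeparture_mul (μ θ : ℝ) (c : ℕ) (h : β < b)
    (hf : f =O[atTop] fun n : ℕ => Real.exp (β * n)) :
    (fun n => erlangADeparture μ θ c n * f n) =O[atTop] fun n : ℕ => Real.exp (b * n) := by
  have hlin : (fun n : ℕ => (n : ℝ)) =O[atTop] fun n : ℕ => Real.exp ((b - β) * n) := by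
    simpa [Function.comp_def] using
      ((isLittleO_pow_exp_pos_mul_atTop (k := 1) (sub_pos.2 h)).comp_tendsto
        tendsto_natCast_atTop_atTop).isBigO
  refine (((isBigO_erlangADeparture μ θ c).trans hlin).mul hf).congr_right fun n => ?_
  rw [← Real.exp_add]
  ring_nf

lemma exists_forall_abs_le_mul_exp (hf : f =O[atTop] fun n : ℕ => Real.exp (b * n)) :
    ∃ C, ∀ n : ℕ, |f n| ≤ C * Real.exp (b * n) := by
  obtain ⟨C, -, hC⟩ := bound_of_isBigO_nat_atTop hf
  exact ⟨C, fun n => by simpa using hC (Real.exp_ne_zero _)⟩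

lemma exists_abs_erlangAGenerator_le (μ θ : ℝ) (c : ℕ) (h : β < b)
    (hf : f =O[atTop] fun n : ℕ => Real.exp (β * n)) (R : ℝ) :
    ∃ K, ∀ g : ℕ → ℝ, (∀ n, |g n| ≤ |f n|) → ∀ r, |r| ≤ R → ∀ n,
      |erlangAGenerator r μ θ c g n| ≤ K * Real.exp (b * n) := by
  have hup : (fun n => R * (|f (n + 1)| + |f n|)) =O[atTop] fun n : ℕ => Real.exp (b * n) :=
    (((isBigO_comp_succ hf).norm_left.add hf.norm_left).const_mul_left R).trans
      (isBigO_exp_mul_of_le h.le)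
  have hdown : (fun n => |erlangADeparture μ θ c n * (|f (n - 1)| + |f n|)|) =O[atTop]
      fun n : ℕ => Real.exp (b * n) :=
    (isBigO_erlangADeparture_mul μ θ c h
      ((isBigO_comp_pred hf).norm_left.add hf.norm_left)).norm_left
  obtain ⟨K, hK⟩ := exists_forall_abs_le_mul_exp (hup.add hdown)
  refine ⟨K, fun g hg r hr n => le_trans ?_ ((le_abs_self _).trans (hK n))⟩
  have hdiff (m k : ℕ) : |g m - g k| ≤ |f m| + |f k| :=
    (abs_sub _ _).trans (add_le_add (hg m) (hg k))
  refine (abs_add_le _ _).trans ?_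
  rw [abs_mul, abs_mul, abs_mul, abs_of_nonneg (a := |f (n - 1)| + |f n|) (by positivity)]
  gcongr
  · exact (abs_nonneg r).trans hr
  · exact hdiff _ _
  · exact hdiff _ _

end Generator

section Queue

open Asymptotics

variable {Ω : Type*} [mΩ : MeasurableSpace Ω] {P : Measure Ω} {ℱ : Filtration ℝ≥0 mΩ}
  {lam lam' : ℝ → ℝ} {μ θ : ℝ} {c : ℕ} {Q : ℝ≥0 → Ω → ℕ} {f : ℕ → ℝ} {b β : ℝ}

/-- The expectation at time `s` of the generator applied to `f`, which by Dynkin's formula is the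
drift of `E[f (Q s)]`. Time is a real number here, as in the martingale problem; negative times are
sent to `0`. -/
noncomputable def erlangADrift (P : Measure Ω) (lam : ℝ → ℝ) (μ θ : ℝ) (c : ℕ)
    (Q : ℝ≥0 → Ω → ℕ) (f : ℕ → ℝ) (s : ℝ) : ℝ :=
  ∫ ω, erlangAGenerator (lam s) μ θ c f (Q s.toNNReal ω) ∂P

/-- The exponential moments of order `b` of the process `Q` are finite, and bounded on bounded time
intervals. -/
def LocallyBoundedExpMoment (P : Measure Ω) (Q : ℝ≥0 → Ω → ℕ) (b : ℝ) : Prop :=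
  ∀ T : ℝ≥0, ∃ B, ∀ t ≤ T, Integrable (fun ω => Real.exp (b * Q t ω)) P ∧
    ∫ ω, Real.exp (b * Q t ω) ∂P ≤ B

lemma LocallyBoundedExpMoment.integrable (h : LocallyBoundedExpMoment P Q b) (t : ℝ≥0) :
    Integrable (fun ω => Real.exp (b * Q t ω)) P :=
  have ⟨_, hB⟩ := h t
  (hB t le_rfl).1

lemma locallyBoundedExpMoment_zero [IsFiniteMeasure P] : LocallyBoundedExpMoment P Q 0 := by
  intro T
  exact ⟨P.real univ, fun t _ => by simp⟩

lemma LocallyBoundedExpMoment.exists_abs_erlangADrift_le (hM : LocallyBoundedExpMoment P Q b)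
    (hlam : Continuous lam) (μ θ : ℝ) (c : ℕ) (h : β < b)
    (hf : f =O[atTop] fun n : ℕ => Real.exp (β * n)) (x y : ℝ) :
    ∃ K, ∀ g : ℕ → ℝ, (∀ n, |g n| ≤ |f n|) → ∀ s ∈ uIcc x y,
      |erlangADrift P lam μ θ c Q g s| ≤ K := by
  obtain ⟨R, hR⟩ := (isCompact_uIcc (a := x) (b := y)).exists_bound_of_continuousOn
    hlam.continuousOn
  obtain ⟨B, hB⟩ := hM (max x y).toNNReal
  obtain ⟨K, hK⟩ := exists_abs_erlangAGenerator_le μ θ c h hf R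
  refine ⟨|K| * B, fun g hg s hs => ?_⟩
  obtain ⟨hint, hle⟩ := hB s.toNNReal (Real.toNNReal_mono hs.2)
  calc |erlangADrift P lam μ θ c Q g s|
      ≤ ∫ ω, |K| * Real.exp (b * Q s.toNNReal ω) ∂P := by
        refine norm_integral_le_of_norm_le (G := ℝ) (hint.const_mul _) (.of_forall fun ω => ?_)
        refine (hK g hg _ (hR s hs) _).trans ?_
        gcongr
        exact le_abs_self K
    _ ≤ |K| * B := by
        rw [integral_const_mul]
        gcongr

namespace IsErlangA

lemma congr_lam (hQ : IsErlangA P ℱ lam μ θ c Q) (h : EqOn lam lam' (Ici 0)) :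
    IsErlangA P ℱ lam' μ θ c Q where
  adapted := hQ.adapted
  right_continuous := hQ.right_continuous
  left_limits := hQ.left_limits
  martingale f hf := by
    convert hQ.martingale f hf using 4 with t ω
    refine intervalIntegral.integral_congr fun s hs => ?_
    rw [uIcc_of_le t.coe_nonneg] at hs
    simp only [h (mem_Ici.2 hs.1)]

lemma measurable (hQ : IsErlangA P ℱ lam μ θ c Q) (t : ℝ≥0) : Measurable (Q t) :=
  (hQ.adapted t).mono (ℱ.le t) le_rfl

lemma measurable_comp (hQ : IsErlangA P ℱ lam μ θ c Q) (f : ℕ → ℝ) (t : ℝ≥0) :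
    Measurable fun ω => f (Q t ω) :=
  (measurable_from_nat (f := f)).comp (hQ.measurable t)

lemma measurable_erlangAGenerator (hQ : IsErlangA P ℱ lam μ θ c Q) (hlam : Continuous lam)
    (f : ℕ → ℝ) :
    Measurable fun x : ℝ × Ω => erlangAGenerator (lam x.1) μ θ c f (Q x.1.toNNReal x.2) := by
  have hcomp (g : ℕ → ℝ) : Measurable fun x : ℝ × Ω => g (Q x.1.toNNReal x.2) :=
    (measurable_from_nat (f := g)).comp
      ((measurable_uncurry_of_rightContinuous hQ.measurable hQ.right_continuous).comp
        ((measurable_real_toNNReal.comp measurable_fst).prodMk measurable_snd))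
  exact ((hlam.measurable.comp measurable_fst).mul (hcomp fun n => f (n + 1) - f n)).add
    (hcomp fun n => erlangADeparture μ θ c n * (f (n - 1) - f n))

lemma integrable_comp (hQ : IsErlangA P ℱ lam μ θ c Q) {t : ℝ≥0}
    (ht : Integrable (fun ω => Real.exp (b * Q t ω)) P)
    (hf : f =O[atTop] fun n : ℕ => Real.exp (b * n)) : Integrable (fun ω => f (Q t ω)) P := by
  obtain ⟨C, hC⟩ := exists_forall_abs_le_mul_exp hf
  exact (ht.const_mul C).mono' (hQ.measurable_comp f t).aestronglyMeasurable
    (.of_forall fun _ => hC _)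

lemma integrable_erlangAGenerator (hQ : IsErlangA P ℱ lam μ θ c Q)
    (hM : LocallyBoundedExpMoment P Q b) (h : β < b)
    (hf : f =O[atTop] fun n : ℕ => Real.exp (β * n)) (r : ℝ) (t : ℝ≥0) :
    Integrable (fun ω => erlangAGenerator r μ θ c f (Q t ω)) P := by
  obtain ⟨K, hK⟩ := exists_abs_erlangAGenerator_le μ θ c h hf |r|
  exact ((hM.integrable t).const_mul K).mono'
    (hQ.measurable_comp (erlangAGenerator r μ θ c f) t).aestronglyMeasurable
    (.of_forall fun _ => hK f (fun _ => le_rfl) r le_rfl _)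

lemma intervalIntegrable_erlangADrift [SFinite P] (hQ : IsErlangA P ℱ lam μ θ c Q)
    (hlam : Continuous lam) (hM : LocallyBoundedExpMoment P Q b) (h : β < b)
    (hf : f =O[atTop] fun n : ℕ => Real.exp (β * n)) (x y : ℝ) :
    IntervalIntegrable (erlangADrift P lam μ θ c Q f) volume x y := by
  obtain ⟨K, hK⟩ := hM.exists_abs_erlangADrift_le hlam μ θ c h hf x y
  have hmeas : StronglyMeasurable (erlangADrift P lam μ θ c Q f) :=
    (hQ.measurable_erlangAGenerator hlam f).stronglyMeasurable.integral_prod_right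
  refine (intervalIntegrable_const (c := K)).mono_fun' hmeas.aestronglyMeasurable ?_
  filter_upwards [ae_restrict_mem measurableSet_uIoc] with s hs
  exact hK f (fun _ => le_rfl) s (uIoc_subset_uIcc hs)

lemma dynkin_of_finite_support [IsFiniteMeasure P] (hQ : IsErlangA P ℱ lam μ θ c Q)
    (hlam : Continuous lam) (hf : f.support.Finite) (t : ℝ≥0) :
    ∫ ω, f (Q t ω) ∂P = ∫ ω, f (Q 0 ω) ∂P + ∫ s in (0 : ℝ)..t, erlangADrift P lam μ θ c Q f s := by
  have hO (β : ℝ) : f =O[atTop] fun n : ℕ => Real.exp (β * n) :=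
    isBigO_exp_mul_of_finite_support hf β
  obtain ⟨R, hR⟩ := (isCompact_uIcc (a := 0) (b := (t : ℝ))).exists_bound_of_continuousOn
    hlam.continuousOn
  obtain ⟨K, hK⟩ := exists_abs_erlangAGenerator_le μ θ c neg_one_lt_zero (hO (-1)) R
  have hint (s : ℝ≥0) : Integrable (fun ω => f (Q s ω)) P :=
    hQ.integrable_comp (locallyBoundedExpMoment_zero.integrable s) (hO 0)
  have hprod : Integrable (Function.uncurry fun (s : ℝ) ω =>
      erlangAGenerator (lam s) μ θ c f (Q s.toNNReal ω))
      ((volume.restrict (uIoc (0 : ℝ) t)).prod P) := by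
    have : IsFiniteMeasure ((volume : Measure ℝ).restrict (uIoc (0 : ℝ) t)) :=
      ⟨by simp [uIoc]⟩
    refine .of_bound (hQ.measurable_erlangAGenerator hlam f).aestronglyMeasurable K ?_
    filter_upwards [Measure.quasiMeasurePreserving_fst.ae (ae_restrict_mem measurableSet_uIoc)]
      with x hx
    simpa [Function.uncurry_def] using
      hK f (fun _ => le_rfl) _ (hR _ (uIoc_subset_uIcc hx)) (Q x.1.toNNReal x.2)
  have hcomp : Integrable (fun ω => ∫ s in (0 : ℝ)..t,
      erlangAGenerator (lam s) μ θ c f (Q s.toNNReal ω)) P := by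
    simpa only [uIoc_of_le t.coe_nonneg, ← intervalIntegral.integral_of_le t.coe_nonneg,
      Function.uncurry_apply_pair]
      using hprod.integral_prod_right
  have hmart := (hQ.martingale f hf).setIntegral_eq (zero_le (a := t)) .univ
  simp only [setIntegral_univ, NNReal.coe_zero, intervalIntegral.integral_same, sub_zero] at hmart
  unfold erlangADrift
  rw [hmart, integral_sub (hint t) hcomp, intervalIntegral_integral_swap hprod, sub_add_cancel]

lemma tendsto_integral_comp_indicator (hQ : IsErlangA P ℱ lam μ θ c Q)
    (hM : LocallyBoundedExpMoment P Q b) (hf : f =O[atTop] fun n : ℕ => Real.exp (b * n))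
    (t : ℝ≥0) :
    Tendsto (fun N => ∫ ω, (Iio N).indicator f (Q t ω) ∂P) atTop (𝓝 (∫ ω, f (Q t ω) ∂P)) := by
  refine tendsto_integral_of_dominated_convergence (fun ω => |f (Q t ω)|)
    (fun N => (hQ.measurable_comp _ t).aestronglyMeasurable)
    (hQ.integrable_comp (hM.integrable t) hf).abs
    (fun N => .of_forall fun ω => norm_indicator_le_norm_self f _)
    (.of_forall fun ω => tendsto_atTop_of_eventually_const (i₀ := Q t ω + 1) fun N hN => ?_)
  exact indicator_of_mem (mem_Iio.2 hN) f

lemma tendsto_erlangADrift_indicator (hQ : IsErlangA P ℱ lam μ θ c Q)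
    (hM : LocallyBoundedExpMoment P Q b) (h : β < b)
    (hf : f =O[atTop] fun n : ℕ => Real.exp (β * n)) (s : ℝ) :
    Tendsto (fun N => erlangADrift P lam μ θ c Q ((Iio N).indicator f) s) atTop
      (𝓝 (erlangADrift P lam μ θ c Q f s)) := by
  obtain ⟨K, hK⟩ := exists_abs_erlangAGenerator_le μ θ c h hf |lam s|
  refine tendsto_integral_of_dominated_convergence
    (fun ω => K * Real.exp (b * Q s.toNNReal ω))
    (fun N => (hQ.measurable_comp (erlangAGenerator (lam s) μ θ c _) _).aestronglyMeasurable)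
    ((hM.integrable _).const_mul K)
    (fun N => .of_forall fun ω => hK _ (norm_indicator_le_norm_self f) _ le_rfl _)
    (.of_forall fun ω => tendsto_atTop_of_eventually_const (i₀ := Q s.toNNReal ω + 2)
      fun N hN => ?_)
  have heq {m : ℕ} (hm : m < N) : (Iio N).indicator f m = f m := indicator_of_mem (mem_Iio.2 hm) f
  unfold erlangAGenerator
  rw [heq (by omega), heq (by omega), heq (by omega)]

lemma dynkin [IsFiniteMeasure P] (hQ : IsErlangA P ℱ lam μ θ c Q) (hlam : Continuous lam)
    (hM : LocallyBoundedExpMoment P Q b) (h : β < b)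
    (hf : f =O[atTop] fun n : ℕ => Real.exp (β * n)) (t : ℝ≥0) :
    ∫ ω, f (Q t ω) ∂P = ∫ ω, f (Q 0 ω) ∂P + ∫ s in (0 : ℝ)..t, erlangADrift P lam μ θ c Q f s := by
  have hfin (N : ℕ) : ((Iio N).indicator f).support.Finite :=
    (finite_Iio N).subset support_indicator_subset
  have hlim := hQ.tendsto_integral_comp_indicator hM (hf.trans (isBigO_exp_mul_of_le h.le))
  obtain ⟨K, hK⟩ := hM.exists_abs_erlangADrift_le hlam μ θ c h hf 0 t
  have hlimDrift : Tendsto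
      (fun N => ∫ s in (0 : ℝ)..t, erlangADrift P lam μ θ c Q ((Iio N).indicator f) s) atTop
      (𝓝 (∫ s in (0 : ℝ)..t, erlangADrift P lam μ θ c Q f s)) :=
    intervalIntegral.tendsto_integral_filter_of_dominated_convergence (fun _ => K)
      (.of_forall fun N => (hQ.intervalIntegrable_erlangADrift hlam locallyBoundedExpMoment_zero
        neg_one_lt_zero (isBigO_exp_mul_of_finite_support (hfin N) _)
        0 t).def'.aestronglyMeasurable)
      (.of_forall fun N => .of_forall fun s hs =>
        hK _ (norm_indicator_le_norm_self f) s (uIoc_subset_uIcc hs))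
      intervalIntegrable_const
      (.of_forall fun s _ => hQ.tendsto_erlangADrift_indicator hM h hf s)
  exact tendsto_nhds_unique (hlim t) (((hlim 0).add hlimDrift).congr fun N =>
    (hQ.dynkin_of_finite_support hlam (hfin N) t).symm)

lemma continuous_integral_comp [IsFiniteMeasure P] (hQ : IsErlangA P ℱ lam μ θ c Q)
    (hlam : Continuous lam) (hM : LocallyBoundedExpMoment P Q b) (h : β < b)
    (hf : f =O[atTop] fun n : ℕ => Real.exp (β * n)) :
    Continuous fun s : ℝ => ∫ ω, f (Q s.toNNReal ω) ∂P := by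
  rw [funext fun s : ℝ => hQ.dynkin hlam hM h hf s.toNNReal]
  exact continuous_const.add ((intervalIntegral.continuous_primitive
    (hQ.intervalIntegrable_erlangADrift hlam hM h hf) 0).comp
    (NNReal.continuous_coe.comp continuous_real_toNNReal))

lemma erlangADrift_eq (hQ : IsErlangA P ℱ lam μ θ c Q) (hM : LocallyBoundedExpMoment P Q b)
    (h : β < b) (hf : f =O[atTop] fun n : ℕ => Real.exp (β * n)) (s : ℝ) :
    erlangADrift P lam μ θ c Q f s =
      lam s * ∫ ω, (f (Q s.toNNReal ω + 1) - f (Q s.toNNReal ω)) ∂P +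
      ∫ ω, erlangADeparture μ θ c (Q s.toNNReal ω) *
        (f (Q s.toNNReal ω - 1) - f (Q s.toNNReal ω)) ∂P := by
  rw [← integral_const_mul, ← integral_add]
  · rfl
  · exact (hQ.integrable_comp (hM.integrable _)
      (((isBigO_comp_succ hf).sub hf).trans (isBigO_exp_mul_of_le h.le))).const_mul _
  · exact hQ.integrable_comp (hM.integrable _)
      (isBigO_erlangADeparture_mul μ θ c h ((isBigO_comp_pred hf).sub hf))

lemma continuous_erlangADrift [IsFiniteMeasure P] (hQ : IsErlangA P ℱ lam μ θ c Q)
    (hlam : Continuous lam) (hM : LocallyBoundedExpMoment P Q b) (h : β < b)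
    (hf : f =O[atTop] fun n : ℕ => Real.exp (β * n)) :
    Continuous (erlangADrift P lam μ θ c Q f) := by
  rw [funext (hQ.erlangADrift_eq hM h hf)]
  exact (hlam.mul (hQ.continuous_integral_comp hlam hM h ((isBigO_comp_succ hf).sub hf))).add
    (hQ.continuous_integral_comp hlam hM (add_div_two_lt_right.2 h)
      (isBigO_erlangADeparture_mul μ θ c (left_lt_add_div_two.2 h) ((isBigO_comp_pred hf).sub hf)))

lemma hasDerivAt_integral_comp [IsFiniteMeasure P] (hQ : IsErlangA P ℱ lam μ θ c Q)
    (hlam : Continuous lam) (hM : LocallyBoundedExpMoment P Q b) (h : β < b)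
    (hf : f =O[atTop] fun n : ℕ => Real.exp (β * n)) {t : ℝ} (ht : 0 < t) :
    HasDerivAt (fun s : ℝ => ∫ ω, f (Q s.toNNReal ω) ∂P) (erlangADrift P lam μ θ c Q f t) t := by
  refine (((hQ.continuous_erlangADrift hlam hM h hf).integral_hasStrictDerivAt 0
    t).hasDerivAt.const_add (∫ ω, f (Q 0 ω) ∂P)).congr_of_eventuallyEq ?_
  filter_upwards [lt_mem_nhds ht] with s hs
  rw [hQ.dynkin hlam hM h hf, Real.coe_toNNReal s hs.le]

lemma integral_comp_le_mul_exp [IsFiniteMeasure P] (hQ : IsErlangA P ℱ lam μ θ c Q)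
    (hlam : Continuous lam) (hM : LocallyBoundedExpMoment P Q b) (h : β < b) {a K T : ℝ}
    (hf : (fun n => f n - a) =O[atTop] fun n : ℕ => Real.exp (β * n)) (hK : 0 ≤ K)
    (hgen : ∀ s ∈ Icc 0 T, ∀ n, erlangAGenerator (lam s) μ θ c f n ≤ K * f n)
    {t : ℝ≥0} (ht : (t : ℝ) ≤ T) :
    ∫ ω, f (Q t ω) ∂P ≤ (∫ ω, f (Q 0 ω) ∂P) * Real.exp (K * t) := by
  set U : ℝ → ℝ := fun s => ∫ ω, f (Q s.toNNReal ω) ∂P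
  have hint (s : ℝ≥0) : Integrable (fun ω => f (Q s ω) - a) P :=
    hQ.integrable_comp (hM.integrable s) (hf.trans (isBigO_exp_mul_of_le h.le))
  have hint' (s : ℝ≥0) : Integrable (fun ω => f (Q s ω)) P :=
    (hint s).add (integrable_const a) |>.congr (.of_forall fun _ => sub_add_cancel _ _)
  have hsub (s : ℝ≥0) : ∫ ω, f (Q s ω) ∂P = ∫ ω, (f (Q s ω) - a) ∂P + ∫ _, a ∂P := by
    rw [integral_sub (hint' s) (integrable_const a), sub_add_cancel]
  have hU : Continuous U := by
    simp only [U, hsub]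
    exact (hQ.continuous_integral_comp hlam hM h hf).add continuous_const
  have hdrift : ∀ s ∈ Icc 0 T, erlangADrift P lam μ θ c Q (fun n => f n - a) s ≤ K * U s := by
    intro s hs
    rw [← integral_const_mul]
    refine integral_mono (hQ.integrable_erlangAGenerator hM h hf _ _) ((hint' _).const_mul K)
      fun ω => ?_
    simpa only [erlangAGenerator, sub_sub_sub_cancel_right] using hgen s hs (Q s.toNNReal ω)
  have hle : ∀ s ∈ Icc 0 T, U s ≤ U 0 + ∫ x in (0 : ℝ)..s, K * U x := by
    intro s hs
    simp only [U]
    rw [hsub, hQ.dynkin hlam hM h hf, Real.coe_toNNReal s hs.1, Real.toNNReal_zero, hsub 0,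
      add_right_comm]
    gcongr
    exact intervalIntegral.integral_mono_on hs.1
      (hQ.intervalIntegrable_erlangADrift hlam hM h hf 0 s)
      ((continuous_const.mul hU).intervalIntegrable _ _)
      fun x hx => hdrift x ⟨hx.1, hx.2.trans hs.2⟩
  simpa [U] using le_mul_exp_of_le_add_integral hU hK hle t ⟨t.coe_nonneg, ht⟩

lemma integral_exp_min_le [IsFiniteMeasure P] (hQ : IsErlangA P ℱ lam μ θ c Q)
    (hlam : Continuous lam) {R T : ℝ} (hlam0 : ∀ s ∈ Icc 0 T, 0 ≤ lam s)
    (hR : ∀ s ∈ Icc 0 T, lam s ≤ R) (hμ : 0 ≤ μ) (hθ : 0 ≤ θ) (hb : 0 ≤ b) (N : ℕ)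
    {t : ℝ≥0} (ht : (t : ℝ) ≤ T) :
    ∫ ω, Real.exp (b * (min (Q t ω) N : ℕ)) ∂P ≤
      (∫ ω, Real.exp (b * (min (Q 0 ω) N : ℕ)) ∂P) * Real.exp (R * (Real.exp b - 1) * t) := by
  have hT : (0 : ℝ) ∈ Icc 0 T := ⟨le_rfl, t.coe_nonneg.trans ht⟩
  have hexp : 0 ≤ Real.exp b - 1 := sub_nonneg.2 (Real.one_le_exp hb)
  have hO : (fun n => Real.exp (b * (min n N : ℕ)) - Real.exp (b * N)) =O[atTop]
      fun n : ℕ => Real.exp (-1 * n) := by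
    refine isBigO_exp_mul_of_finite_support ((finite_Iio N).subset fun n hn => ?_) _
    contrapose! hn
    rw [Function.notMem_support, min_eq_right (notMem_Iio.1 hn), sub_self]
  refine hQ.integral_comp_le_mul_exp hlam locallyBoundedExpMoment_zero neg_one_lt_zero hO
    (mul_nonneg ((hlam0 0 hT).trans (hR 0 hT)) hexp) (fun s hs n => ?_) ht
  refine (erlangAGenerator_exp_min_le (hlam0 s hs) hμ hθ c hb N n).trans ?_
  gcongr
  exact hR s hs

lemma locallyBoundedExpMoment [IsFiniteMeasure P] (hQ : IsErlangA P ℱ lam μ θ c Q)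
    (hlam : Continuous lam) (hlam0 : ∀ s, 0 ≤ s → 0 ≤ lam s) (hμ : 0 ≤ μ) (hθ : 0 ≤ θ) (hb : 0 ≤ b)
    (hint : Integrable (fun ω => Real.exp (b * Q 0 ω)) P) : LocallyBoundedExpMoment P Q b := by
  intro T
  obtain ⟨R, hR⟩ := (isCompact_Icc (a := 0) (b := (T : ℝ))).bddAbove_image hlam.continuousOn
  have hR' : ∀ s ∈ Icc (0 : ℝ) T, lam s ≤ R := fun s hs => hR ⟨s, hs, rfl⟩
  have hT : (0 : ℝ) ∈ Icc (0 : ℝ) T := ⟨le_rfl, T.coe_nonneg⟩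
  have hK : 0 ≤ R * (Real.exp b - 1) :=
    mul_nonneg ((hlam0 0 le_rfl).trans (hR' 0 hT)) (sub_nonneg.2 (Real.one_le_exp hb))
  have hint' (N : ℕ) (t : ℝ≥0) : Integrable (fun ω => Real.exp (b * (min (Q t ω) N : ℕ))) P := by
    refine .of_bound
      (hQ.measurable_comp (fun n => Real.exp (b * (min n N : ℕ))) t).aestronglyMeasurable
      (Real.exp (b * N)) (.of_forall fun ω => ?_)
    rw [Real.norm_of_nonneg (Real.exp_nonneg _)]
    gcongr
    exact min_le_right _ _
  refine ⟨(∫ ω, Real.exp (b * Q 0 ω) ∂P) * Real.exp (R * (Real.exp b - 1) * T), fun t ht =>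
    integrable_and_integral_le_of_tendsto_of_nonneg (hint' · t) (fun _ _ => Real.exp_nonneg _)
      (fun ω => tendsto_atTop_of_eventually_const (i₀ := Q t ω) fun N hN => by rw [min_eq_left hN])
      fun N => (hQ.integral_exp_min_le hlam (fun s hs => hlam0 s hs.1) hR' hμ hθ hb N
        (NNReal.coe_le_coe.2 ht)).trans ?_⟩
  refine mul_le_mul (integral_mono (hint' N 0) hint fun ω => ?_) (by gcongr)
    (Real.exp_nonneg _) (integral_nonneg fun _ => Real.exp_nonneg _)
  dsimp only
  gcongr
  exact min_le_left _ _

end IsErlangA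

end Queue

section NonnegMGF

variable {Ω : Type*} [MeasurableSpace Ω] {P : Measure Ω} {X : Ω → ℝ} {b : ℝ}

lemma integrable_exp_mul_of_le_of_nonneg (hX : AEMeasurable X P) (hX0 : ∀ ω, 0 ≤ X ω)
    (hint : Integrable (fun ω => Real.exp (b * X ω)) P) {α : ℝ} (h : α ≤ b) :
    Integrable (fun ω => Real.exp (α * X ω)) P := by
  refine hint.mono' (by fun_prop) (.of_forall fun ω => ?_)
  rw [Real.norm_of_nonneg (Real.exp_nonneg _)]
  gcongr
  exact hX0 ω

lemma monotoneOn_mgf_of_nonneg (hX : AEMeasurable X P) (hX0 : ∀ ω, 0 ≤ X ω)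
    (hint : Integrable (fun ω => Real.exp (b * X ω)) P) : MonotoneOn (mgf X P) (Iic b) := by
  intro α hα β hβ hαβ
  refine integral_mono (integrable_exp_mul_of_le_of_nonneg hX hX0 hint hα)
    (integrable_exp_mul_of_le_of_nonneg hX hX0 hint hβ) fun ω => ?_
  have := hX0 ω
  dsimp only
  gcongr

lemma continuousOn_mgf_of_nonneg (hX : AEMeasurable X P) (hX0 : ∀ ω, 0 ≤ X ω)
    (hint : Integrable (fun ω => Real.exp (b * X ω)) P) : ContinuousOn (mgf X P) (Iic b) := by
  refine continuousOn_of_dominated (fun α _ => by fun_prop) (fun α hα => .of_forall fun ω => ?_)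
    hint (.of_forall fun ω => by fun_prop)
  have := hX0 ω
  rw [Real.norm_of_nonneg (Real.exp_nonneg _)]
  gcongr
  exact hα

lemma mem_interior_integrableExpSet_of_nonneg (hX : AEMeasurable X P) (hX0 : ∀ ω, 0 ≤ X ω)
    (hint : Integrable (fun ω => Real.exp (b * X ω)) P) {α : ℝ} (h : α < b) :
    α ∈ interior (integrableExpSet X P) :=
  mem_interior.2 ⟨Iio b, fun _ hβ => integrable_exp_mul_of_le_of_nonneg hX hX0 hint (le_of_lt hβ),
    isOpen_Iio, h⟩

lemma hasDerivAt_mgf_of_nonneg (hX : AEMeasurable X P) (hX0 : ∀ ω, 0 ≤ X ω)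
    (hint : Integrable (fun ω => Real.exp (b * X ω)) P) {α : ℝ} (h : α < b) :
    HasDerivAt (mgf X P) (∫ ω, X ω * Real.exp (α * X ω) ∂P) α :=
  hasDerivAt_mgf (mem_interior_integrableExpSet_of_nonneg hX hX0 hint h)

lemma integrable_mul_exp_of_nonneg (hX : AEMeasurable X P) (hX0 : ∀ ω, 0 ≤ X ω)
    (hint : Integrable (fun ω => Real.exp (b * X ω)) P) {α : ℝ} (h : α < b) :
    Integrable (fun ω => X ω * Real.exp (α * X ω)) P := by
  simpa using integrable_pow_mul_exp_of_mem_interior_integrableExpSet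
    (mem_interior_integrableExpSet_of_nonneg hX hX0 hint h) 1

lemma integrable_min_mul_exp_of_nonneg (hX : AEMeasurable X P) (hX0 : ∀ ω, 0 ≤ X ω)
    (hint : Integrable (fun ω => Real.exp (b * X ω)) P) {α : ℝ} (h : α < b) {k : ℝ} (hk : 0 ≤ k) :
    Integrable (fun ω => min (X ω) k * Real.exp (α * X ω)) P := by
  refine (integrable_mul_exp_of_nonneg hX hX0 hint h).mono' (by fun_prop) (.of_forall fun ω => ?_)
  rw [Real.norm_of_nonneg (mul_nonneg (le_min (hX0 ω) hk) (Real.exp_nonneg _))]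
  gcongr
  exact min_le_left _ _

lemma integral_min_mul_exp_le (hX : AEMeasurable X P) (hX0 : ∀ ω, 0 ≤ X ω)
    (hint : Integrable (fun ω => Real.exp (b * X ω)) P) {α : ℝ} (h : α < b) {k : ℝ} (hk : 0 ≤ k) :
    ∫ ω, min (X ω) k * Real.exp (α * X ω) ∂P ≤
      min (∫ ω, X ω * Real.exp (α * X ω) ∂P) (k * mgf X P α) := by
  have hmin := integrable_min_mul_exp_of_nonneg hX hX0 hint h hk
  refine le_min (integral_mono hmin (integrable_mul_exp_of_nonneg hX hX0 hint h) fun ω => ?_) ?_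
  · dsimp only
    gcongr
    exact min_le_left _ _
  · rw [mgf, ← integral_const_mul]
    refine integral_mono hmin
      ((integrable_exp_mul_of_le_of_nonneg hX hX0 hint h.le).const_mul k) fun ω => ?_
    dsimp only
    gcongr
    exact min_le_right _ _

end NonnegMGF

section QueueMGF

lemma mul_nonneg_of_mem_uIcc {x a α : ℝ} (h : 0 ≤ x * a) (hα : α ∈ uIcc 0 a) : 0 ≤ x * α := by
  have hmem : x * α ∈ uIcc (x * 0) (x * a) := by
    rw [← image_const_mul_uIcc]
    exact mem_image_of_mem _ hα
  rw [mul_zero, uIcc_of_le h] at hmem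
  exact hmem.1

variable {Ω : Type*} [mΩ : MeasurableSpace Ω] {P : Measure Ω} {ℱ : Filtration ℝ≥0 mΩ}
  {lam : ℝ → ℝ} {μ θ : ℝ} {c : ℕ} {Q : ℝ≥0 → Ω → ℕ} {a b t T α : ℝ}

/-- The moment generating function of the process `Q`, as a function of the time and of the
exponent. Time is a real number, as in the closure equation; negative times are sent to `0`. -/
noncomputable def queueMGF (P : Measure Ω) (Q : ℝ≥0 → Ω → ℕ) (t : ℝ) : ℝ → ℝ :=
  mgf (fun ω => (Q t.toNNReal ω : ℝ)) P

lemma queueMGF_coe (P : Measure Ω) (Q : ℝ≥0 → Ω → ℕ) (t : ℝ≥0) :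
    queueMGF P Q t = mgf (fun ω => (Q t ω : ℝ)) P := by
  rw [queueMGF, Real.toNNReal_coe]

namespace IsErlangA

lemma aemeasurable_cast (hQ : IsErlangA P ℱ lam μ θ c Q) (t : ℝ≥0) :
    AEMeasurable (fun ω => (Q t ω : ℝ)) P :=
  (hQ.measurable_comp Nat.cast t).aemeasurable

lemma continuousOn_queueMGF_left (hQ : IsErlangA P ℱ lam μ θ c Q)
    (hM : LocallyBoundedExpMoment P Q b) (t : ℝ) : ContinuousOn (queueMGF P Q t) (Iic b) :=
  continuousOn_mgf_of_nonneg (hQ.aemeasurable_cast _) (fun _ => Nat.cast_nonneg _)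
    (hM.integrable _)

lemma hasDerivAt_queueMGF (hQ : IsErlangA P ℱ lam μ θ c Q) (hM : LocallyBoundedExpMoment P Q b)
    (h : α < b) (t : ℝ) :
    HasDerivAt (queueMGF P Q t)
      (∫ ω, Q t.toNNReal ω * Real.exp (α * Q t.toNNReal ω) ∂P) α :=
  hasDerivAt_mgf_of_nonneg (hQ.aemeasurable_cast _) (fun _ => Nat.cast_nonneg _)
    (hM.integrable _) h

lemma continuousOn_queueMGF_prod [IsFiniteMeasure P] (hQ : IsErlangA P ℱ lam μ θ c Q)
    (hlam : Continuous lam) (hM : LocallyBoundedExpMoment P Q b) (hb : 0 ≤ b)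
    (hab : ∀ α ∈ uIcc 0 a, α ≠ 0 → α < b) (S : Set ℝ) :
    ContinuousOn (fun z : ℝ × ℝ => queueMGF P Q z.1 z.2) (S ×ˢ uIcc 0 a) := by
  have hJ : uIcc 0 a ⊆ Iic b := fun α hα => by
    rcases eq_or_ne α 0 with rfl | hα0
    exacts [hb, (hab α hα hα0).le]
  refine continuousOn_prod_of_monotoneOn (fun α hα => ?_)
    (fun t _ => (hQ.continuousOn_queueMGF_left hM t).mono hJ) fun t _ =>
      (monotoneOn_mgf_of_nonneg (hQ.aemeasurable_cast _) (fun _ => Nat.cast_nonneg _)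
        (hM.integrable _)).mono hJ
  rcases eq_or_ne α 0 with rfl | hα0
  · simp only [queueMGF, mgf_zero', continuousOn_const]
  · exact (hQ.continuous_integral_comp hlam hM (hab α hα hα0)
      (isBigO_exp_mul_of_le le_rfl)).continuousOn

lemma hasDerivAt_queueMGF_time [IsFiniteMeasure P] (hQ : IsErlangA P ℱ lam μ θ c Q)
    (hlam : Continuous lam) (hM : LocallyBoundedExpMoment P Q b) (h : α < b) (ht : 0 < t) :
    HasDerivAt (fun s => queueMGF P Q s α)
      (lam t * (Real.exp α - 1) * queueMGF P Q t α + (Real.exp (-α) - 1) *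
        ∫ ω, erlangADeparture μ θ c (Q t.toNNReal ω) * Real.exp (α * Q t.toNNReal ω) ∂P) t := by
  have hO := isBigO_exp_mul_of_le (le_refl α)
  refine (hQ.hasDerivAt_integral_comp hlam hM h hO ht).congr_deriv ?_
  simp only [erlangADrift, erlangAGenerator_exp]
  rw [integral_add, integral_const_mul, integral_const_mul]
  · rfl
  · exact (hQ.integrable_comp (hM.integrable _) (isBigO_exp_mul_of_le h.le)).const_mul _
  · exact (hQ.integrable_comp (hM.integrable _)
      (isBigO_erlangADeparture_mul μ θ c h hO)).const_mul _

/-- The number `δ` is the closure error `∂_α M ∧ c M - E[(Q ∧ c) exp (α * Q)]`. -/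
lemma exists_closure_error (hQ : IsErlangA P ℱ lam μ θ c Q) {t : ℝ≥0}
    (hint : Integrable (fun ω => Real.exp (b * Q t ω)) P) (h : α < b) :
    ∃ δ, 0 ≤ δ ∧ ∫ ω, erlangADeparture μ θ c (Q t ω) * Real.exp (α * Q t ω) ∂P =
      fluidDeparture μ θ c (mgf (fun ω => (Q t ω : ℝ)) P α)
        (∫ ω, Q t ω * Real.exp (α * Q t ω) ∂P) + (θ - μ) * δ := by
  have hX := hQ.aemeasurable_cast t
  have hX0 (ω : Ω) : (0 : ℝ) ≤ Q t ω := Nat.cast_nonneg _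
  refine ⟨_, sub_nonneg.2 (integral_min_mul_exp_le hX hX0 hint h (Nat.cast_nonneg c)), ?_⟩
  simp only [fluidDeparture_eq, erlangADeparture_eq, sub_mul (θ * _), mul_assoc]
  rw [integral_sub ((integrable_mul_exp_of_nonneg hX hX0 hint h).const_mul θ)
    ((integrable_min_mul_exp_of_nonneg hX hX0 hint h (Nat.cast_nonneg c)).const_mul (θ - μ)),
    integral_const_mul, integral_const_mul]
  ring

lemma exists_hasDerivAt_queueMGF_time [IsFiniteMeasure P] (hQ : IsErlangA P ℱ lam μ θ c Q)
    (hlam : Continuous lam) (hM : LocallyBoundedExpMoment P Q b) (h : α < b) (ht : 0 < t) :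
    ∃ δ, 0 ≤ δ ∧ HasDerivAt (fun s => queueMGF P Q s α)
      (fluidRHS (lam t) μ θ c α (queueMGF P Q t α)
        (∫ ω, Q t.toNNReal ω * Real.exp (α * Q t.toNNReal ω) ∂P) +
        (Real.exp (-α) - 1) * ((θ - μ) * δ)) t := by
  obtain ⟨δ, hδ, hgap⟩ := hQ.exists_closure_error (hM.integrable t.toNNReal) h
  refine ⟨δ, hδ, (hQ.hasDerivAt_queueMGF_time hlam hM h ht).congr_deriv ?_⟩
  rw [hgap, fluidRHS_eq, mul_add, add_assoc]
  rfl

lemma isFluidSubsolution_queueMGF [IsFiniteMeasure P] (hQ : IsErlangA P ℱ lam μ θ c Q)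
    (hlam : Continuous lam) (hM : LocallyBoundedExpMoment P Q b) (hb : 0 ≤ b)
    (hab : ∀ α ∈ uIcc 0 a, α ≠ 0 → α < b) (hsign : 0 ≤ (θ - μ) * a) (T : ℝ) :
    IsFluidSubsolution lam μ θ c T (uIcc 0 a) (queueMGF P Q) where
  continuousOn := hQ.continuousOn_queueMGF_prod hlam hM hb hab _
  deriv_le t ht α hα hα0 := by
    obtain ⟨δ, hδ, hderiv⟩ := hQ.exists_hasDerivAt_queueMGF_time hlam hM (hab α hα hα0) ht.1
    refine ⟨_, _, (hQ.hasDerivAt_queueMGF hM (hab α hα hα0) t).hasDerivWithinAt, hderiv,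
      add_le_of_nonpos_right (mul_exp_neg_sub_one_nonpos ?_)⟩
    rw [← mul_assoc, mul_comm α]
    exact mul_nonneg (mul_nonneg_of_mem_uIcc hsign hα) hδ

lemma isFluidSupersolution_queueMGF [IsFiniteMeasure P] (hQ : IsErlangA P ℱ lam μ θ c Q)
    (hlam : Continuous lam) (hM : LocallyBoundedExpMoment P Q b) (hb : 0 ≤ b)
    (hab : ∀ α ∈ uIcc 0 a, α ≠ 0 → α < b) (hsign : 0 ≤ (μ - θ) * a) (T : ℝ) :
    IsFluidSupersolution lam μ θ c T (uIcc 0 a) (queueMGF P Q) where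
  continuousOn := hQ.continuousOn_queueMGF_prod hlam hM hb hab _
  le_deriv t ht α hα hα0 := by
    obtain ⟨δ, hδ, hderiv⟩ := hQ.exists_hasDerivAt_queueMGF_time hlam hM (hab α hα hα0) ht.1
    refine ⟨_, _, (hQ.hasDerivAt_queueMGF hM (hab α hα hα0) t).hasDerivWithinAt, hderiv,
      le_add_of_nonneg_right ?_⟩
    have hgap : (Real.exp (-α) - 1) * ((μ - θ) * δ) ≤ 0 := by
      refine mul_exp_neg_sub_one_nonpos ?_
      rw [← mul_assoc, mul_comm α]
      exact mul_nonneg (mul_nonneg_of_mem_uIcc hsign hα) hδ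
    linarith

section Comparison

variable [IsFiniteMeasure P] {I : Set ℝ} {M : ℝ → ℝ → ℝ}

lemma queueMGF_comparison_of_lt (hQ : IsErlangA P ℱ lam μ θ c Q)
    (hlam : Continuous lam) (hμ : 0 ≤ μ) (hθ : 0 ≤ θ) (hmom : LocallyBoundedExpMoment P Q b)
    (hb : 0 ≤ b) (hab : ∀ α ∈ uIcc 0 a, α ≠ 0 → α < b) (haI : uIcc 0 a ⊆ I)
    (hM : IsFluidMGF lam μ θ c T I M) (hinit : ∀ α ∈ I, M 0 α = queueMGF P Q 0 α)
    (ht : t ∈ Icc 0 T) :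
    (0 ≤ (θ - μ) * a → queueMGF P Q t a ≤ M t a) ∧
      (0 ≤ (μ - θ) * a → M t a ≤ queueMGF P Q t a) := by
  have hinit' : ∀ α ∈ uIcc 0 a, M 0 α = queueMGF P Q 0 α := fun α hα => hinit α (haI hα)
  have hbdry : ∀ s ∈ Icc 0 T, M s 0 = queueMGF P Q s 0 := fun s hs => by
    rw [hM.apply_zero (haI left_mem_uIcc) hs, hinit' 0 left_mem_uIcc, queueMGF, queueMGF,
      mgf_zero', mgf_zero']
  refine ⟨fun hsign => ?_, fun hsign => ?_⟩
  · exact (hQ.isFluidSubsolution_queueMGF hlam hmom hb hab hsign T).le_supersolution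
      (hM.isFluidSupersolution haI) hlam.continuousOn hμ hθ (fun α hα => (hinit' α hα).ge)
      (fun s hs => (hbdry s hs).ge) t ht a right_mem_uIcc
  · exact (hM.isFluidSubsolution haI).le_supersolution
      (hQ.isFluidSupersolution_queueMGF hlam hmom hb hab hsign T) hlam.continuousOn hμ hθ
      (fun α hα => (hinit' α hα).le) (fun s hs => (hbdry s hs).le) t ht a right_mem_uIcc

lemma queueMGF_comparison (hQ : IsErlangA P ℱ lam μ θ c Q) (hlam : Continuous lam)
    (hlam0 : ∀ s, 0 ≤ s → 0 ≤ lam s) (hμ : 0 ≤ μ) (hθ : 0 ≤ θ) (hI : I.OrdConnected)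
    (hI0 : (0 : ℝ) ∈ I) (hexp : ∀ α ∈ I, Integrable (fun ω => Real.exp (α * Q 0 ω)) P)
    (hM : IsFluidMGF lam μ θ c T I M) (hinit : ∀ α ∈ I, M 0 α = queueMGF P Q 0 α)
    (ht : t ∈ Icc 0 T) (hα : α ∈ I) :
    (0 ≤ (θ - μ) * α → queueMGF P Q t α ≤ M t α) ∧
      (0 ≤ (μ - θ) * α → M t α ≤ queueMGF P Q t α) := by
  rcases le_or_gt α 0 with hα0 | hα0
  · refine hQ.queueMGF_comparison_of_lt hlam hμ hθ locallyBoundedExpMoment_zero le_rfl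
      (fun β hβ hβ0 => ?_) (hI.uIcc_subset hI0 hα) hM hinit ht
    rw [uIcc_of_ge hα0] at hβ
    exact hβ.2.lt_of_ne hβ0
  -- The moment of order `α` may be the largest finite one, in which case only left
  -- continuity of `queueMGF` at `α` is available: the comparison is made at smaller exponents.
  have hmom := hQ.locallyBoundedExpMoment hlam hlam0 hμ hθ hα0.le (hexp α hα)
  have hsub : uIcc 0 α ⊆ I := hI.uIcc_subset hI0 hα
  have hIoo : ∀ a ∈ Ioo 0 α, a ∈ uIcc 0 α := fun a ha =>
    Icc_subset_uIcc (Ioo_subset_Icc_self ha)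
  have hcomp : ∀ a ∈ Ioo 0 α, (0 ≤ (θ - μ) * a → queueMGF P Q t a ≤ M t a) ∧
      (0 ≤ (μ - θ) * a → M t a ≤ queueMGF P Q t a) := fun a ha =>
    hQ.queueMGF_comparison_of_lt hlam hμ hθ hmom hα0.le
      (fun β hβ _ => ((uIcc_of_le ha.1.le ▸ hβ).2.trans_lt ha.2))
      (hI.uIcc_subset hI0 (hsub (hIoo a ha))) hM hinit ht
  have hclosure : α ∈ closure (Ioo 0 α) := by
    rw [closure_Ioo hα0.ne]
    exact right_mem_Icc.2 hα0.le
  have hq : ContinuousWithinAt (queueMGF P Q t) (Ioo 0 α) α :=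
    (hQ.continuousOn_queueMGF_left hmom t α self_mem_Iic).mono fun a ha => ha.2.le
  have hf : ContinuousWithinAt (M t) (Ioo 0 α) α :=
    (hM.continuousOn.uncurry_left t ht α hα).mono fun a ha => hsub (hIoo a ha)
  exact ⟨fun hsign => ContinuousWithinAt.closure_le hclosure hq hf fun a ha => (hcomp a ha).1
      (mul_nonneg_of_mem_uIcc hsign (hIoo a ha)),
    fun hsign => ContinuousWithinAt.closure_le hclosure hf hq fun a ha => (hcomp a ha).2
      (mul_nonneg_of_mem_uIcc hsign (hIoo a ha))⟩

end Comparison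

end IsErlangA

end QueueMGF

theorem theorem3 {Ω : Type*} [mΩ : MeasurableSpace Ω] (P : Measure Ω) [IsProbabilityMeasure P]
    (ℱ : Filtration ℝ≥0 mΩ)
    (lam : ℝ → ℝ) (hlam_cont : ContinuousOn lam (Ici 0)) (hlam_nonneg : ∀ t, 0 ≤ t → 0 ≤ lam t)
    (μ θ : ℝ) (hμ : 0 < μ) (hθ : 0 ≤ θ) (c : ℕ) (hc : 0 < c)
    (Q : ℝ≥0 → Ω → ℕ) (hQ : IsErlangA P ℱ lam μ θ c Q)
    (T : ℝ) (I : Set ℝ) (hI : I.OrdConnected) (hI0 : (0 : ℝ) ∈ I)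
    (hexp : ∀ α ∈ I, Integrable (fun ω => Real.exp (α * (Q 0 ω : ℝ))) P)
    (Mf : ℝ → ℝ → ℝ) (hMf : IsFluidMGF lam μ θ c T I Mf)
    (hinit : ∀ α ∈ I, Mf 0 α = mgf (fun ω => (Q 0 ω : ℝ)) P α) :
    (∀ t : ℝ≥0, (t : ℝ) ≤ T → ∀ α ∈ I,
      Integrable (fun ω => Real.exp (α * (Q t ω : ℝ))) P) ∧
    (θ < μ → ∀ t : ℝ≥0, (t : ℝ) ≤ T → ∀ α ∈ I,
      (0 ≤ α → Mf t α ≤ mgf (fun ω => (Q t ω : ℝ)) P α) ∧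
      (α ≤ 0 → mgf (fun ω => (Q t ω : ℝ)) P α ≤ Mf t α)) ∧
    (μ < θ → ∀ t : ℝ≥0, (t : ℝ) ≤ T → ∀ α ∈ I,
      (0 ≤ α → mgf (fun ω => (Q t ω : ℝ)) P α ≤ Mf t α) ∧
      (α ≤ 0 → Mf t α ≤ mgf (fun ω => (Q t ω : ℝ)) P α)) ∧
    (θ = μ → ∀ t : ℝ≥0, (t : ℝ) ≤ T → ∀ α ∈ I,
      mgf (fun ω => (Q t ω : ℝ)) P α = Mf t α) := by
  have hlam : EqOn lam (fun s => lam (max s 0)) (Ici 0) := fun s hs => by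
    simp only [max_eq_left (mem_Ici.1 hs)]
  have hcont : Continuous fun s => lam (max s 0) :=
    hlam_cont.comp_continuous (by fun_prop) fun s => mem_Ici.2 (le_max_right _ _)
  have hnonneg : ∀ s, 0 ≤ s → 0 ≤ lam (max s 0) := fun s _ => hlam_nonneg _ (le_max_right _ _)
  have hQ' := hQ.congr_lam hlam
  have hcomp (t : ℝ≥0) (ht : (t : ℝ) ≤ T) (α : ℝ) (hα : α ∈ I) :=
    queueMGF_coe P Q t ▸ hQ'.queueMGF_comparison hcont hnonneg hμ.le hθ hI hI0 hexp
      (hMf.congr_lam hlam) (by simpa [queueMGF] using hinit) ⟨t.coe_nonneg, ht⟩ hα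
  refine ⟨fun t _ α hα => ?_, fun h t ht α hα => ⟨fun hα0 => ?_, fun hα0 => ?_⟩,
    fun h t ht α hα => ⟨fun hα0 => ?_, fun hα0 => ?_⟩, fun h t ht α hα => le_antisymm ?_ ?_⟩
  · have hmax : max α 0 ∈ I := by rcases max_choice α 0 with h | h <;> rwa [h]
    have hmom := hQ'.locallyBoundedExpMoment hcont hnonneg hμ.le hθ (le_max_right α 0)
      (hexp _ hmax)
    exact hQ'.integrable_comp (hmom.integrable t) (isBigO_exp_mul_of_le (le_max_left α 0))
  · exact (hcomp t ht α hα).2 (mul_nonneg (by linarith) hα0)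
  · exact (hcomp t ht α hα).1 (mul_nonneg_of_nonpos_of_nonpos (by linarith) hα0)
  · exact (hcomp t ht α hα).1 (mul_nonneg (by linarith) hα0)
  · exact (hcomp t ht α hα).2 (mul_nonneg_of_nonpos_of_nonpos (by linarith) hα0)
  · exact (hcomp t ht α hα).1 (by simp [h])
  · exact (hcomp t ht α hα).2 (by simp [h])
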